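/- **Setting.** Let $G$ be a noncompact linear reductive group, i.e. a noncompact closed subgroup of $\mathrm{GL}(N,\mathbb R)$ or $\mathrm{GL}(N,\mathbb C)$ which is stable under conjugate transpose, let $K\subset G$ be a maximal compact subgroup, and let $Q=G/K$ carry a nonzero $G$-invariant Radon measure $\gamma_Q$ (it is unique up to a positive factor). For $\nu\ge 2$ let $\mathcal M=Q^\nu$ with the product measure $\gamma$ and the diagonal action $g(q_1,\dots,q_\nu)=(gq_1,\dots,gq_\nu)$, and let $(\ell_{\mathcal M}(g)\psi)(m)=\psi(g^{-1}m)$ on $L^2(\mathcal M)=L^2(\mathcal M,\gamma;\mathbb C)$. A *standard invariant selfadjoint operator* is an integral operator $(\mathbf A\psi)(m)=\int A(m,m')\psi(m')\,d\gamma(m')$ on $L^2(\mathcal M)$ with a continuous kernel $A:\mathcal M\times\mathcal M\to\mathbb C$ such that $A(m',m)=\overline{A(m,m')}$, $A(gm,gm')=A(m,m')$ for all $g\in G$, and $\sup_m\int|A(m,m')|\,d\gamma(m')<\infty$. A *transfer operator* is an integral operator $\mathbf T$ on $L^2(\mathcal M)$ which is positive, $(\psi,\mathbf T\psi)\ge 0$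 for all $\psi$, and has a continuous symmetric kernel $T:\mathcal M\times\mathcal M\to[0,\infty)$ with $T>0$ almost everywhere and $\sup_m\int T(m,m')\,d\gamma(m')<\infty$. For a bounded selfadjoint operator, the discrete spectrum is the set of eigenvalues of finite multiplicity that are isolated points of the spectrum, the essential spectrum is the complement of the discrete spectrum in the spectrum, and the continuous spectrum is the spectrum of the restriction of the operator to the orthogonal complement of the span of its eigenvectors. **Proposition 3.1.** (a) Every standard invariant selfadjoint operator $\mathbf A$ on $L^2(\mathcal M)$ has purely essential spectrum: $\mathrm{Spec}(\mathbf A)=\mathrm{ess\text{-}Spec}(\mathbf A)$. (b) Let $\mathbf T$ be a transfer operator on $L^2(\mathcal M)$ that commutes with $\ell_{\mathcal M}(g)$ for every $g\in G$. Then $\mathbf T$ has no normalizable ground state: there is no $0\ne\psi\in L^2(\mathcal M)$ with $\mathbf T\psi=\|\mathbf T\|\,\psi$. Hence $\|\mathbf T\|$ lies in the continuous spectrum of $\mathbf T$, or $\|\mathbf T\|$ is a limit point of the set of eigenvalues of $\mathbf T$ of infinite multiplicity. -/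

import Mathlib

open MeasureTheory Filter Topology
open scoped ENNReal MatrixGroups InnerProductSpace

noncomputable section

namespace SpinSystem

/-! ### The symmetry group, the space `Q = G / K` and the configuration space -/

/-- A linear reductive group: a closed subgroup of `GL(N, 𝕜)`, `𝕜 = ℝ` or `ℂ`, which is stable
under conjugate transpose. -/
structure IsLinearReductive {𝕜 : Type*} [RCLike 𝕜] {N : ℕ} (G : Subgroup (GL (Fin N) 𝕜)) :
    Prop where
  isClosed : IsClosed (G : Set (GL (Fin N) 𝕜))
  conjTranspose_mem : ∀ g ∈ G, ∃ h ∈ G,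
    (h : Matrix (Fin N) (Fin N) 𝕜) = (g : Matrix (Fin N) (Fin N) 𝕜).conjTranspose

/-- `K` is a maximal element among the compact subgroups of `G`. -/
def IsMaximalCompact {G : Type*} [Group G] [TopologicalSpace G] (K : Subgroup G) : Prop :=
  Maximal (fun L : Subgroup G => IsCompact (L : Set G)) K

instance secondCountableTopology_GL {𝕜 : Type*} [RCLike 𝕜] {N : ℕ} :
    SecondCountableTopology (GL (Fin N) 𝕜) :=
  haveI : SecondCountableTopology (Matrix (Fin N) (Fin N) 𝕜) :=
    inferInstanceAs (SecondCountableTopology (Fin N → Fin N → 𝕜))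
  haveI : SecondCountableTopology (Matrix (Fin N) (Fin N) 𝕜)ᵐᵒᵖ :=
    MulOpposite.opHomeomorph.symm.secondCountableTopology
  Units.isEmbedding_embedProduct.secondCountableTopology

instance {𝕜 : Type*} [RCLike 𝕜] {N : ℕ} (G : Subgroup (GL (Fin N) 𝕜)) :
    SecondCountableTopology G :=
  TopologicalSpace.Subtype.secondCountableTopology (G : Set (GL (Fin N) 𝕜))

section SpinSpace

variable {G : Type*} [Group G] [TopologicalSpace G]

/-- The space `Q = G / K` of values of a single spin, with the quotient topology, its Borel
σ-algebra and the left action of `G`. -/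
def SpinSpace (K : Subgroup G) : Type _ := G ⧸ K

instance (K : Subgroup G) : TopologicalSpace (SpinSpace K) :=
  inferInstanceAs (TopologicalSpace (G ⧸ K))

instance (K : Subgroup G) : MeasurableSpace (SpinSpace K) := borel _

instance (K : Subgroup G) : BorelSpace (SpinSpace K) := ⟨rfl⟩

instance (K : Subgroup G) : MulAction G (SpinSpace K) :=
  inferInstanceAs (MulAction G (G ⧸ K))

instance [IsTopologicalGroup G] (K : Subgroup G) : ContinuousConstSMul G (SpinSpace K) :=
  inferInstanceAs (ContinuousConstSMul G (G ⧸ K))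

instance [IsTopologicalGroup G] [SecondCountableTopology G] (K : Subgroup G) :
    SecondCountableTopology (SpinSpace K) :=
  inferInstanceAs (SecondCountableTopology (G ⧸ K))

/-- The configuration space `M = Q^ν`, with the product topology and σ-algebra and the diagonal
action `g • (q₁, …, q_ν) = (g • q₁, …, g • q_ν)` of `G`. -/
abbrev Config (K : Subgroup G) (ν : ℕ) : Type _ := Fin ν → SpinSpace K

/-- The product measure `dγ(q₁) ⋯ dγ(q_ν)` on `M = Q^ν`. -/
abbrev configMeasure {K : Subgroup G} (γ : Measure (SpinSpace K)) (ν : ℕ) :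
    Measure (Config K ν) :=
  Measure.pi fun _ => γ

/-- The product measure is invariant under the diagonal action. -/
instance [IsTopologicalGroup G] [SecondCountableTopology G] {K : Subgroup G}
    (γ : Measure (SpinSpace K)) [IsLocallyFiniteMeasure γ] [SMulInvariantMeasure G (SpinSpace K) γ]
    (ν : ℕ) : SMulInvariantMeasure G (Config K ν) (configMeasure γ ν) where
  measure_preimage_smul g _ hs :=
    (measurePreserving_pi (fun _ : Fin ν => γ) (fun _ => γ)
      (fun _ => measurePreserving_smul g γ)).measure_preimage hs.nullMeasurableSet

end SpinSpace

/-! ### Operators on `L²` -/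

section Operators

variable {X : Type*} [MeasurableSpace X]

/-- The space `L²(X, μ)` of complex valued square integrable functions. -/
abbrev L2 (μ : Measure X) : Type _ := Lp ℂ 2 μ

/-- The unitary operator `(ℓ(g) ψ)(m) = ψ(g⁻¹ m)` on `L²(X, μ)`. -/
def leftRep {G : Type*} [Group G] [MulAction G X] [MeasurableConstSMul G X] (μ : Measure X)
    [SMulInvariantMeasure G X μ] (g : G) : L2 μ →L[ℂ] L2 μ :=
  (Lp.compMeasurePreservingₗᵢ ℂ (fun m : X => g⁻¹ • m)
    (measurePreserving_smul g⁻¹ μ)).toContinuousLinearMap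

/-- `T` is the integral operator with kernel `k`, that is `(T ψ)(m) = ∫ k(m, m') ψ(m') dμ(m')`
for almost every `m`. It is only used for kernels with `sup_m ∫ |k(m, m')| dμ(m') < ∞` and
`|k(m, m')| = |k(m', m)|`; then the integral converges absolutely for almost every `m`. -/
def HasKernel (μ : Measure X) (T : L2 μ →L[ℂ] L2 μ) (k : X → X → ℂ) : Prop :=
  ∀ ψ : L2 μ, ∀ᵐ m ∂μ, T ψ m = ∫ m', k m m' * ψ m' ∂μ

/-- A standard invariant selfadjoint operator: an integral operator whose kernel is continuous,
(hermitian) symmetric, invariant under the action of `G` and satisfies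
`sup_m ∫ |A(m, m')| dμ(m') < ∞`. -/
def IsStandardInvariant (G : Type*) [Group G] [MulAction G X] [TopologicalSpace X]
    (μ : Measure X) (A : L2 μ →L[ℂ] L2 μ) : Prop :=
  ∃ k : X → X → ℂ,
    Continuous (fun p : X × X => k p.1 p.2) ∧
    (∀ m m', k m' m = starRingEnd ℂ (k m m')) ∧
    (∀ (g : G) (m m'), k (g • m) (g • m') = k m m') ∧
    (⨆ m, ∫⁻ m', ‖k m m'‖ₑ ∂μ) < ∞ ∧
    HasKernel μ A k

/-- A transfer operator: a positive integral operator whose kernel takes values in `[0, ∞)`, is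
symmetric, continuous, strictly positive almost everywhere, and satisfies
`sup_m ∫ T(m, m') dμ(m') < ∞`. -/
def IsTransferOperator [TopologicalSpace X] (μ : Measure X) (T : L2 μ →L[ℂ] L2 μ) : Prop :=
  T.IsPositive ∧
  ∃ k : X → X → ℝ,
    Continuous (fun p : X × X => k p.1 p.2) ∧
    (∀ m m', k m' m = k m m') ∧
    (∀ m m', 0 ≤ k m m') ∧
    (∀ᵐ p ∂(μ.prod μ), 0 < k p.1 p.2) ∧
    (⨆ m, ∫⁻ m', ENNReal.ofReal (k m m') ∂μ) < ∞ ∧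
    HasKernel μ T (fun m m' => (k m m' : ℂ))

end Operators

/-! ### Parts of the spectrum of a bounded selfadjoint operator -/

section Spectrum

variable {H : Type*} [NormedAddCommGroup H] [InnerProductSpace ℂ H]

/-- The eigenspace of `A` for `z`. -/
abbrev eigenspace (A : H →L[ℂ] H) (z : ℂ) : Submodule ℂ H :=
  Module.End.eigenspace A.toLinearMap z

/-- The discrete spectrum: the eigenvalues of finite multiplicity which are isolated points of
the spectrum. -/
def discreteSpectrum (A : H →L[ℂ] H) : Set ℂ :=
  {z | z ∈ spectrum ℂ A ∧ ¬ AccPt z (𝓟 (spectrum ℂ A)) ∧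
    eigenspace A z ≠ ⊥ ∧ FiniteDimensional ℂ (eigenspace A z)}

/-- The essential spectrum of a selfadjoint operator: the complement of the discrete spectrum in
the spectrum. -/
def essentialSpectrum (A : H →L[ℂ] H) : Set ℂ :=
  spectrum ℂ A \ discreteSpectrum A

/-- The eigenvalues of infinite multiplicity. -/
def infiniteEigenvalues (A : H →L[ℂ] H) : Set ℂ :=
  {z | ¬ FiniteDimensional ℂ (eigenspace A z)}

/-- The continuous subspace of a selfadjoint operator: the orthogonal complement of the span of
all eigenvectors. -/
def continuousSubspace (A : H →L[ℂ] H) : Submodule ℂ H :=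
  (⨆ z : ℂ, eigenspace A z)ᗮ

instance [CompleteSpace H] (A : H →L[ℂ] H) : (continuousSubspace A).HasOrthogonalProjection :=
  inferInstanceAs ((⨆ z : ℂ, eigenspace A z)ᗮ).HasOrthogonalProjection

/-- The part of `A` in its continuous subspace. A selfadjoint `A` maps that subspace to itself, so
that the orthogonal projection only adjusts the codomain. -/
def continuousPart [CompleteSpace H] (A : H →L[ℂ] H) :
    continuousSubspace A →L[ℂ] continuousSubspace A :=
  (continuousSubspace A).orthogonalProjectionOnto ∘L A ∘L (continuousSubspace A).subtypeL

/-- The continuous spectrum of a selfadjoint operator: the spectrum of its restriction to the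
continuous subspace. -/
def continuousSpectrum [CompleteSpace H] (A : H →L[ℂ] H) : Set ℂ :=
  spectrum ℂ (continuousPart A)

end Spectrum

end SpinSystem

end

/-! Since `K` is compact, `G` acts properly on `Q`: translates of a relatively compact set leave it
as `g → ∞`. Hence the matrix coefficients of `ℓ` on `L²(M)` vanish at infinity
(`tendsto_inner_leftRep`, `exists_exhaustion`), and as `G` is noncompact, `ℓ` has no nonzero finite
dimensional invariant subspace. Eigenspaces of an operator commuting with `ℓ` are invariant, so each
is zero or infinite dimensional; this empties the discrete spectrum.

For a transfer operator, a Perron–Frobenius argument (`map_modulus`, `ae_ne_zero`) turns a ground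
state into a nonnegative one fixed by `ℓ`, whose constant matrix coefficient contradicts the decay.
Finally `‖T‖` is in the spectrum. Were it outside the continuous spectrum and not a limit of
eigenvalues, `T - ‖T‖` would be bounded below on the continuous subspace and on its complement,
hence invertible (`mem_continuousSpectrum_or_accPt`). -/

namespace SpinSystem

/-! ### Decay of matrix coefficients and its effect on eigenspaces -/

section Mixing

variable {X : Type*} [MeasurableSpace X] {μ : Measure X}

/-- Truncate `f` to `B n`: the squared error is the mass of `(B n)ᶜ` under the finite measure `|f|²
dμ`, and these sets decrease to `∅`. -/
lemma exists_supported_norm_sub_lt {B : ℕ → Set X} (hmono : Monotone B)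
    (hmeas : ∀ n, MeasurableSet (B n)) (hcover : ⋃ n, B n = Set.univ) (f : L2 μ) {ε : ℝ}
    (hε : 0 < ε) :
    ∃ n, ∃ f' : L2 μ, (∀ᵐ x ∂μ, x ∉ B n → f' x = 0) ∧ ‖f - f'‖ < ε := by
  have hfin : ∫⁻ x, ‖f x‖ₑ ^ (2 : ℝ) ∂μ < ∞ := by
    have := (eLpNorm_lt_top_iff_lintegral_rpow_enorm_lt_top two_ne_zero
      ENNReal.ofNat_ne_top).1 (Lp.memLp f).2
    simpa using this
  set κ : Measure X := μ.withDensity fun x => ‖f x‖ₑ ^ (2 : ℝ) with hκ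
  have : IsFiniteMeasure κ := isFiniteMeasure_withDensity hfin.ne
  have hlim : Tendsto (fun n => κ (B n)ᶜ) atTop (𝓝 0) := by
    have h := tendsto_measure_iInter_atTop (μ := κ) (s := fun n => (B n)ᶜ)
      (fun n => (hmeas n).compl.nullMeasurableSet)
      (fun m n hmn => Set.compl_subset_compl.2 (hmono hmn)) ⟨0, measure_ne_top _ _⟩
    rwa [← Set.compl_iUnion, hcover, Set.compl_univ, measure_empty] at h
  have hlim' : Tendsto (fun n => (κ (B n)ᶜ) ^ (1 / 2 : ℝ)) atTop (𝓝 0) := by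
    simpa using hlim.ennrpow_const (1 / 2 : ℝ)
  obtain ⟨n, hn⟩ := (hlim'.eventually_lt_const (ENNReal.ofReal_pos.2 hε)).exists
  refine ⟨n, ((Lp.memLp f).indicator (hmeas n)).toLp _, ?_, ?_⟩
  · filter_upwards [((Lp.memLp f).indicator (hmeas n)).coeFn_toLp] with x hx hxB
    rw [hx, Set.indicator_of_notMem hxB]
  · rw [Lp.norm_def]
    have hsub : ⇑(f - ((Lp.memLp f).indicator (hmeas n)).toLp _) =ᵐ[μ]
        ((B n)ᶜ).indicator f := by
      filter_upwards [((Lp.memLp f).indicator (hmeas n)).coeFn_toLp, Lp.coeFn_sub f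
        (((Lp.memLp f).indicator (hmeas n)).toLp _)] with x hx hx'
      rw [hx', Pi.sub_apply, hx, Set.indicator_compl, Pi.sub_apply]
    rw [eLpNorm_congr_ae hsub, eLpNorm_indicator_eq_eLpNorm_restrict (hmeas n).compl,
      eLpNorm_eq_lintegral_rpow_enorm_toReal two_ne_zero ENNReal.ofNat_ne_top]
    rw [hκ, withDensity_apply _ (hmeas n).compl] at hn
    rw [← ENNReal.toReal_ofReal hε.le]
    refine ENNReal.toReal_strict_mono ENNReal.ofReal_ne_top ?_
    simpa using hn

variable {Γ : Type*} [Group Γ] [MulAction Γ X] [MeasurableConstSMul Γ X]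
  [SMulInvariantMeasure Γ X μ]

lemma leftRep_coeFn (g : Γ) (ψ : L2 μ) : ⇑(leftRep μ g ψ) =ᵐ[μ] fun m => ψ (g⁻¹ • m) :=
  Lp.coeFn_compMeasurePreserving ψ (measurePreserving_smul g⁻¹ μ)

lemma norm_leftRep (g : Γ) (ψ : L2 μ) : ‖leftRep μ g ψ‖ = ‖ψ‖ :=
  (Lp.compMeasurePreservingₗᵢ ℂ (fun m : X => g⁻¹ • m)
    (measurePreserving_smul g⁻¹ μ)).norm_map ψ

/-- Matrix coefficients of `ℓ` vanish at infinity when translates of the members of an exhaustion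
are eventually disjoint from them. -/
lemma tendsto_inner_leftRep {B : ℕ → Set X} (hmono : Monotone B)
    (hmeas : ∀ n, MeasurableSet (B n)) (hcover : ⋃ n, B n = Set.univ) {l : Filter Γ}
    (hdisj : ∀ n, ∀ᶠ g in l, ∀ x ∈ B n, g⁻¹ • x ∉ B n) (f h : L2 μ) :
    Tendsto (fun g => ⟪f, leftRep μ g h⟫_ℂ) l (𝓝 0) := by
  rw [Metric.tendsto_nhds]
  intro ε hε
  -- `f'` is fixed before `h'` because the error in `h` gets multiplied by `‖f'‖`; the `+ 1` keeps
  -- the denominators positive.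
  obtain ⟨n₁, f', hf', hff'⟩ := exists_supported_norm_sub_lt hmono hmeas hcover f
    (ε := ε / 2 / (‖h‖ + 1)) (by positivity)
  obtain ⟨n₂, h', hh', hhh'⟩ := exists_supported_norm_sub_lt hmono hmeas hcover h
    (ε := ε / 2 / (‖f'‖ + 1)) (by positivity)
  filter_upwards [hdisj (max n₁ n₂)] with g hg
  have hzero : ⟪f', leftRep μ g h'⟫_ℂ = 0 := by
    rw [L2.inner_def]
    refine integral_eq_zero_of_ae ?_
    filter_upwards [hf', leftRep_coeFn g h',
      (measurePreserving_smul g⁻¹ μ).quasiMeasurePreserving.ae hh'] with x hx hgx hhx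
    by_cases hxB : x ∈ B n₁
    · have : g⁻¹ • x ∉ B n₂ := fun hc =>
        hg x (hmono (le_max_left _ _) hxB) (hmono (le_max_right _ _) hc)
      simp [hgx, hhx this]
    · simp [hx hxB]
  have hsplit : ⟪f, leftRep μ g h⟫_ℂ =
      ⟪f - f', leftRep μ g h⟫_ℂ + ⟪f', leftRep μ g (h - h')⟫_ℂ := by
    rw [map_sub, inner_sub_left, inner_sub_right, hzero]
    ring
  rw [dist_zero_right, hsplit]
  calc ‖⟪f - f', leftRep μ g h⟫_ℂ + ⟪f', leftRep μ g (h - h')⟫_ℂ‖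
      ≤ ‖f - f'‖ * ‖h‖ + ‖f'‖ * ‖h - h'‖ := by
        refine (norm_add_le _ _).trans (add_le_add ?_ ?_)
        · simpa only [norm_leftRep] using norm_inner_le_norm (𝕜 := ℂ) (f - f') (leftRep μ g h)
        · simpa only [norm_leftRep] using norm_inner_le_norm (𝕜 := ℂ) f' (leftRep μ g (h - h'))
    _ < ε / 2 + ε / 2 := by
        refine add_lt_add ?_ ?_
        · rw [lt_div_iff₀ (by positivity)] at hff'
          nlinarith [norm_nonneg (f - f')]
        · rw [lt_div_iff₀ (by positivity)] at hhh'
          nlinarith [norm_nonneg (h - h')]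
    _ = ε := by ring

end Mixing

/-- A family of isometries whose matrix coefficients tend to zero has no nonzero finite dimensional
invariant subspace. -/
lemma eq_bot_of_tendsto_inner_zero {H Γ : Type*} [NormedAddCommGroup H] [InnerProductSpace ℂ H]
    {U : Γ → H → H} (hU : ∀ g x, ‖U g x‖ = ‖x‖) {l : Filter Γ} [l.NeBot]
    (hmix : ∀ x y, Tendsto (fun g => ⟪x, U g y⟫_ℂ) l (𝓝 0)) (E : Submodule ℂ H)
    [FiniteDimensional ℂ E] (hE : ∀ g, ∀ x ∈ E, U g x ∈ E) : E = ⊥ := by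
  refine (Submodule.eq_bot_iff _).2 fun x hx => ?_
  let b := stdOrthonormalBasis ℂ E
  -- `U g x` stays in `E`, so Parseval keeps this finite sum constant while each term tends to zero.
  have hsum : ∀ g, ∑ i, ‖⟪(b i : H), U g x⟫_ℂ‖ ^ 2 = ‖x‖ ^ 2 := fun g => by
    have h := b.sum_sq_norm_inner_right ⟨U g x, hE g x hx⟩
    simpa [hU] using h
  have hlim : Tendsto (fun g => ∑ i, ‖⟪(b i : H), U g x⟫_ℂ‖ ^ 2) l (𝓝 0) := by
    have := tendsto_finsetSum Finset.univ (f := fun i g => ‖⟪(b i : H), U g x⟫_ℂ‖ ^ 2)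
      (a := fun _ => (0 : ℝ)) (x := l) fun i _ => by simpa using ((hmix (b i) x).norm.pow 2)
    simpa using this
  simp only [hsum] at hlim
  simpa using tendsto_nhds_unique tendsto_const_nhds hlim

/-- An eigenspace of an operator commuting with such a family is zero or infinite dimensional. -/
lemma eigenspace_eq_bot_of_commute {H Γ : Type*} [NormedAddCommGroup H] [InnerProductSpace ℂ H]
    {U : Γ → H →L[ℂ] H} (hU : ∀ g x, ‖U g x‖ = ‖x‖) {l : Filter Γ} [l.NeBot]
    (hmix : ∀ x y, Tendsto (fun g => ⟪x, U g y⟫_ℂ) l (𝓝 0)) {A : H →L[ℂ] H}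
    (hA : ∀ g, U g ∘L A = A ∘L U g) (z : ℂ) (hfin : FiniteDimensional ℂ (eigenspace A z)) :
    eigenspace A z = ⊥ := by
  refine eq_bot_of_tendsto_inner_zero (U := fun g => U g) hU hmix _ fun g x hx => ?_
  rw [Module.End.mem_eigenspace_iff] at hx ⊢
  have h := congrArg (fun S : H →L[ℂ] H => S x) (hA g)
  simp only [ContinuousLinearMap.comp_apply] at h
  change A x = z • x at hx
  change A (U g x) = z • U g x
  rw [← h, hx, map_smul]

/-! ### Properness of the action on `Q^ν` -/

section Exhaustion

open scoped Pointwise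

variable {G : Type*} [Group G] [TopologicalSpace G] [IsTopologicalGroup G]
  [SecondCountableTopology G] [LocallyCompactSpace G]

/-- One coordinate suffices: if `aK` and `g⁻¹aK = bK` with `a, b ∈ C n`, then `g` lies in the
compact set `C n * K * (C n)⁻¹`. Interiors are used so that `V n` is open, hence Borel. -/
lemma exists_exhaustion {K : Subgroup G} (hK : IsCompact (K : Set G)) {ν : ℕ} (hν : ν ≠ 0) :
    ∃ B : ℕ → Set (Config K ν), Monotone B ∧ (∀ n, MeasurableSet (B n)) ∧
      ⋃ n, B n = Set.univ ∧ ∀ n, ∀ᶠ g in cocompact G, ∀ x ∈ B n, g⁻¹ • x ∉ B n := by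
  let C : CompactExhaustion G := default
  let p : G → SpinSpace K := fun g => (QuotientGroup.mk g : G ⧸ K)
  let V : ℕ → Set (SpinSpace K) := fun n => p '' interior (C n)
  have hVmono : Monotone V := fun m n hmn => Set.image_mono (interior_mono (C.subset hmn))
  have hVopen : ∀ n, IsOpen (V n) := fun n =>
    (QuotientGroup.isOpenMap_coe (N := K)) _ isOpen_interior
  have hVcover : ∀ q, ∃ n, q ∈ V n := fun q => by
    obtain ⟨a, rfl⟩ := QuotientGroup.mk_surjective (s := K) q
    obtain ⟨n, hn⟩ := C.exists_mem a
    exact ⟨n + 1, a, C.subset_interior_succ n hn, rfl⟩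
  refine ⟨fun n => Set.univ.pi fun _ => V n, fun m n hmn => Set.pi_mono fun _ _ => hVmono hmn,
    fun n => MeasurableSet.univ_pi fun _ => (hVopen n).measurableSet, ?_, fun n => ?_⟩
  · refine Set.eq_univ_of_forall fun x => ?_
    choose n hn using fun i => hVcover (x i)
    exact Set.mem_iUnion.2 ⟨Finset.univ.sup n, fun i _ =>
      hVmono (Finset.le_sup (Finset.mem_univ i)) (hn i)⟩
  · have hcpt : IsCompact ((C n : Set G) * (K : Set G) * (C n : Set G)⁻¹) :=
      ((C.isCompact n).mul hK).mul (C.isCompact n).inv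
    filter_upwards [hcpt.compl_mem_cocompact] with g hg x hx hgx
    refine hg ?_
    let i : Fin ν := ⟨0, Nat.pos_of_ne_zero hν⟩
    obtain ⟨a, ha, hax⟩ := hx i trivial
    obtain ⟨b, hb, hbx⟩ := hgx i trivial
    have hab : (QuotientGroup.mk b : G ⧸ K) = QuotientGroup.mk (g⁻¹ * a) := by
      change p b = g⁻¹ • p a
      rw [hbx, hax]
      rfl
    rw [QuotientGroup.eq] at hab
    refine ⟨a * (b⁻¹ * (g⁻¹ * a))⁻¹, ⟨a, interior_subset ha, _, K.inv_mem hab, rfl⟩, b⁻¹,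
      Set.inv_mem_inv.2 (interior_subset hb), ?_⟩
    simp only
    group

end Exhaustion

end SpinSystem

namespace SpinSystem

/-! ### Invariant kernels and the Perron–Frobenius argument -/

section Kernels

variable {X : Type*} [MeasurableSpace X] {μ : Measure X}

/-- Substitute `m' ↦ g • m'` in the integral and use invariance of the measure and of the kernel. -/
lemma IsStandardInvariant.leftRep_comm {Γ : Type*} [Group Γ] [MulAction Γ X]
    [MeasurableConstSMul Γ X] [SMulInvariantMeasure Γ X μ] [TopologicalSpace X]
    {A : L2 μ →L[ℂ] L2 μ} (hA : IsStandardInvariant Γ μ A) (g : Γ) :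
    leftRep μ g ∘L A = A ∘L leftRep μ g := by
  obtain ⟨k, -, -, hinv, -, hk⟩ := hA
  refine ContinuousLinearMap.ext fun ψ => Lp.ext ?_
  filter_upwards [leftRep_coeFn g (A ψ), hk (leftRep μ g ψ),
    (measurePreserving_smul g⁻¹ μ).quasiMeasurePreserving.ae (hk ψ)] with m h₁ h₂ h₃
  simp only [ContinuousLinearMap.comp_apply]
  rw [h₁, h₂, h₃]
  have h₄ : ∫ m', k m m' * leftRep μ g ψ m' ∂μ = ∫ m', k m m' * ψ (g⁻¹ • m') ∂μ := by
    refine integral_congr_ae ?_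
    filter_upwards [leftRep_coeFn g ψ] with m' hm'
    rw [hm']
  rw [h₄, ← integral_smul_eq_self (μ := μ) (fun m' => k m m' * ψ (g⁻¹ • m')) (g := g)]
  simp only [inv_smul_smul]
  refine integral_congr_ae (Eventually.of_forall fun m' => ?_)
  simp only
  rw [← hinv g (g⁻¹ • m) m', smul_inv_smul]

/-- The function `f` is real and nonnegative almost everywhere. -/
def IsNonneg (f : L2 μ) : Prop := ∀ᵐ x ∂μ, f x = (‖f x‖ : ℂ)

/-- The pointwise absolute value. -/
noncomputable def modulus (f : L2 μ) : L2 μ := MemLp.toLp (fun x => ((‖f x‖ : ℝ) : ℂ)) (Lp.memLp f).norm.ofReal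

lemma modulus_coeFn (f : L2 μ) : ⇑(modulus f) =ᵐ[μ] fun x => (‖f x‖ : ℂ) :=
  MemLp.coeFn_toLp (μ := μ) (f := fun x => ((‖f x‖ : ℝ) : ℂ)) _

lemma isNonneg_modulus (f : L2 μ) : IsNonneg (modulus f) := by
  filter_upwards [modulus_coeFn f] with x hx
  simp [hx]

lemma norm_modulus (f : L2 μ) : ‖modulus f‖ = ‖f‖ := by
  rw [Lp.norm_def, Lp.norm_def]
  refine congrArg _ (eLpNorm_congr_norm_ae ?_)
  filter_upwards [modulus_coeFn f] with x hx
  simp [hx]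

lemma re_inner_nonneg_of_ae {f h : L2 μ} (H : ∀ᵐ x ∂μ, 0 ≤ RCLike.re ⟪f x, h x⟫_ℂ) :
    0 ≤ RCLike.re ⟪f, h⟫_ℂ := by
  rw [L2.inner_def, ← integral_re (L2.integrable_inner f h)]
  exact integral_nonneg_of_ae H

lemma IsNonneg.re_inner_nonneg {f h : L2 μ} (hf : IsNonneg f) (hh : IsNonneg h) :
    0 ≤ RCLike.re ⟪f, h⟫_ℂ := by
  refine re_inner_nonneg_of_ae ?_
  filter_upwards [hf, hh] with x hx hx'
  rw [hx, hx']
  simp [RCLike.inner_apply]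
  positivity

/-- Put `f = |ψ|` and `h = T f - ‖T‖ f`. Pointwise `‖T‖ |ψ| = |T ψ| ≤ T |ψ|`, so `h ≥ 0` and `Re ⟪f,
h⟫ ≥ 0`. Expanding `‖T f‖² = ‖‖T‖ f + h‖²` against `‖T f‖² ≤ ‖T‖² ‖f‖²` forces `h = 0`. -/
lemma IsTransferOperator.map_modulus [TopologicalSpace X] {T : L2 μ →L[ℂ] L2 μ}
    (hT : IsTransferOperator μ T) {ψ : L2 μ} (hψ : T ψ = (‖T‖ : ℂ) • ψ) :
    T (modulus ψ) = (‖T‖ : ℂ) • modulus ψ := by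
  obtain ⟨-, k, -, -, hk0, -, -, hk⟩ := hT
  have hre : 0 ≤ RCLike.re ⟪modulus ψ, T (modulus ψ) - (‖T‖ : ℂ) • modulus ψ⟫_ℂ := by
    refine re_inner_nonneg_of_ae ?_
    filter_upwards [modulus_coeFn ψ, hk (modulus ψ), hk ψ, Lp.coeFn_sub (T (modulus ψ))
      ((‖T‖ : ℂ) • modulus ψ), Lp.coeFn_smul (‖T‖ : ℂ) (modulus ψ), Lp.coeFn_smul (‖T‖ : ℂ) ψ]
      with m h₁ h₂ h₃ h₄ h₅ h₆
    have h₇ : T (modulus ψ) m = ((∫ m', k m m' * ‖ψ m'‖ ∂μ : ℝ) : ℂ) := by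
      rw [h₂, ← integral_complex_ofReal]
      refine integral_congr_ae ?_
      filter_upwards [modulus_coeFn ψ] with m' hm'
      rw [hm']
      push_cast
      rfl
    have h₈ : ‖T‖ * ‖ψ m‖ ≤ ∫ m', k m m' * ‖ψ m'‖ ∂μ := by
      have h₉ : ‖T ψ m‖ = ‖T‖ * ‖ψ m‖ := by
        rw [hψ, h₆]
        simp
      rw [← h₉, h₃]
      refine (norm_integral_le_integral_norm _).trans_eq ?_
      refine integral_congr_ae (Eventually.of_forall fun m' => ?_)
      simp [abs_of_nonneg (hk0 m m')]
    rw [h₄, Pi.sub_apply, h₅, Pi.smul_apply, h₁, h₇, smul_eq_mul, ← Complex.ofReal_mul,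
      ← Complex.ofReal_sub, RCLike.inner_apply, Complex.conj_ofReal, ← Complex.ofReal_mul]
    exact mul_nonneg (sub_nonneg.2 h₈) (norm_nonneg _)
  set f := modulus ψ
  set c := ‖T‖
  have h₁ : ‖T f - (c : ℂ) • f‖ ^ 2 ≤ 0 := by
    have h₂ : ‖T f‖ ^ 2 ≤ (c * ‖f‖) ^ 2 := pow_le_pow_left₀ (norm_nonneg _) (T.le_opNorm f) 2
    have h₃ : ‖T f‖ ^ 2 = ‖(c : ℂ) • f + (T f - (c : ℂ) • f)‖ ^ 2 := by
      rw [add_sub_cancel]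
    rw [@norm_add_sq ℂ, inner_smul_left, norm_smul] at h₃
    have h₄ : RCLike.re ((starRingEnd ℂ) (c : ℂ) * ⟪f, T f - (c : ℂ) • f⟫_ℂ) =
        c * RCLike.re ⟪f, T f - (c : ℂ) • f⟫_ℂ := by
      rw [Complex.conj_ofReal]
      exact Complex.re_ofReal_mul _ _
    have h₅ : ‖(c : ℂ)‖ = c := by simp [c]
    rw [h₄, h₅] at h₃
    have h₆ : 0 ≤ c * RCLike.re ⟪f, T f - (c : ℂ) • f⟫_ℂ := mul_nonneg (norm_nonneg _) hre
    linarith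
  have h₂ : ‖T f - (c : ℂ) • f‖ = 0 := by
    have := sq_nonneg ‖T f - (c : ℂ) • f‖
    exact pow_eq_zero_iff two_ne_zero |>.1 (le_antisymm h₁ this)
  exact sub_eq_zero.1 (norm_eq_zero.1 h₂)

variable [TopologicalSpace X] [SecondCountableTopology X] [OpensMeasurableSpace X] [SFinite μ]

/-- Schur's test: the integral defining the operator converges absolutely almost everywhere. -/
lemma ae_integrable_kernel_mul_norm {k : X → X → ℝ} (hcont : Continuous fun p : X × X => k p.1 p.2)
    (hsymm : ∀ m m', k m' m = k m m') (hk0 : ∀ m m', 0 ≤ k m m')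
    (hbdd : (⨆ m, ∫⁻ m', ENNReal.ofReal (k m m') ∂μ) < ∞) (f : L2 μ) :
    ∀ᵐ m ∂μ, Integrable (fun m' => k m m' * ‖f m'‖) μ := by
  have hkm : Measurable fun p : X × X => ENNReal.ofReal (k p.1 p.2) :=
    hcont.measurable.ennreal_ofReal
  have hfm : Measurable fun x => ‖f x‖ₑ ^ (2 : ℝ) :=
    (Lp.stronglyMeasurable f).enorm.pow_const _
  have hfin : ∫⁻ x, ‖f x‖ₑ ^ (2 : ℝ) ∂μ < ∞ := by
    have := (eLpNorm_lt_top_iff_lintegral_rpow_enorm_lt_top two_ne_zero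
      ENNReal.ofNat_ne_top).1 (Lp.memLp f).2
    simpa using this
  have hprod : Measurable fun p : X × X =>
      ENNReal.ofReal (k p.1 p.2) * ‖f p.2‖ₑ ^ (2 : ℝ) :=
    hkm.mul (hfm.comp measurable_snd)
  -- By symmetry of `k`, the supremum bounding row integrals also bounds column integrals.
  have htonelli : ∫⁻ m, ∫⁻ m', ENNReal.ofReal (k m m') * ‖f m'‖ₑ ^ (2 : ℝ) ∂μ ∂μ < ∞ := by
    rw [lintegral_lintegral_swap hprod.aemeasurable]
    calc ∫⁻ m', ∫⁻ m, ENNReal.ofReal (k m m') * ‖f m'‖ₑ ^ (2 : ℝ) ∂μ ∂μ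
        ≤ ∫⁻ m', (⨆ m, ∫⁻ m', ENNReal.ofReal (k m m') ∂μ) * ‖f m'‖ₑ ^ (2 : ℝ) ∂μ := by
          refine lintegral_mono fun m' => ?_
          have hkm' : Measurable fun m => ENNReal.ofReal (k m m') := hkm.comp measurable_prodMk_right
          rw [lintegral_mul_const _ hkm']
          gcongr
          simp only [hsymm m']
          exact le_iSup (fun m => ∫⁻ m', ENNReal.ofReal (k m m') ∂μ) m'
      _ = (⨆ m, ∫⁻ m', ENNReal.ofReal (k m m') ∂μ) * ∫⁻ m', ‖f m'‖ₑ ^ (2 : ℝ) ∂μ :=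
          lintegral_const_mul _ hfm
      _ < ∞ := ENNReal.mul_lt_top hbdd hfin
  filter_upwards [ae_lt_top hprod.lintegral_prod_right' htonelli.ne] with m hm
  have hmk : Measurable fun m' => ENNReal.ofReal (k m m') := hkm.comp measurable_prodMk_left
  refine ⟨((hcont.measurable.comp measurable_prodMk_left).mul
    (Lp.stronglyMeasurable f).measurable.norm).aestronglyMeasurable, ?_⟩
  -- From `t ≤ 1 + t²`: `k |f| ≤ k + k |f|²`, and both terms have finite integral.
  calc ∫⁻ m', ‖k m m' * ‖f m'‖‖ₑ ∂μ
      ≤ ∫⁻ m', (ENNReal.ofReal (k m m') +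
          ENNReal.ofReal (k m m') * ‖f m'‖ₑ ^ (2 : ℝ)) ∂μ := by
        refine lintegral_mono fun m' => ?_
        rw [enorm_mul, enorm_norm, Real.enorm_of_nonneg (hk0 m m'),
          ← mul_one_add (ENNReal.ofReal (k m m'))]
        gcongr
        rcases le_total ‖f m'‖ₑ 1 with h | h
        · exact h.trans le_self_add
        · refine le_add_left ?_
          simpa using ENNReal.rpow_le_rpow_of_exponent_le h (one_le_two (α := ℝ))
    _ = ∫⁻ m', ENNReal.ofReal (k m m') ∂μ +
          ∫⁻ m', ENNReal.ofReal (k m m') * ‖f m'‖ₑ ^ (2 : ℝ) ∂μ := lintegral_add_left hmk _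
    _ < ∞ := ENNReal.add_lt_top.2 ⟨(le_iSup (fun m => ∫⁻ m', ENNReal.ofReal (k m m') ∂μ) m).trans_lt
        hbdd, hm⟩

/-- A transfer operator improves positivity. -/
lemma IsTransferOperator.ae_ne_zero {T : L2 μ →L[ℂ] L2 μ} (hT : IsTransferOperator μ T) {f : L2 μ}
    (hf : IsNonneg f) (hf0 : f ≠ 0) : ∀ᵐ m ∂μ, T f m ≠ 0 := by
  obtain ⟨-, k, hcont, hsymm, hk0, hpos, hbdd, hk⟩ := hT
  filter_upwards [hk f, ae_integrable_kernel_mul_norm hcont hsymm hk0 hbdd f,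
    Measure.ae_ae_of_ae_prod hpos] with m h₁ h₂ h₃ hzero
  have h₄ : T f m = ((∫ m', k m m' * ‖f m'‖ ∂μ : ℝ) : ℂ) := by
    rw [h₁, ← integral_complex_ofReal]
    refine integral_congr_ae ?_
    filter_upwards [hf] with m' hm'
    rw [hm']
    simp
  -- Integrability is essential here: a divergent integral would also be zero, by default.
  rw [hzero, eq_comm, Complex.ofReal_eq_zero,
    integral_eq_zero_iff_of_nonneg (fun m' => mul_nonneg (hk0 m m') (norm_nonneg _)) h₂] at h₄
  refine hf0 ((Lp.eq_zero_iff_ae_eq_zero).2 ?_)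
  filter_upwards [h₃, h₄] with m' h h'
  simpa [h.ne'] using h'

/-- An operator which commutes with `ℓ` has no ground state if matrix coefficients of `ℓ` vanish
along some filter: the ground state would be unique up to a factor. -/
lemma IsTransferOperator.eq_zero_of_map_eq {Γ : Type*} [Group Γ] [MulAction Γ X]
    [MeasurableConstSMul Γ X] [SMulInvariantMeasure Γ X μ] {T : L2 μ →L[ℂ] L2 μ}
    (hT : IsTransferOperator μ T) (hcomm : ∀ g : Γ, leftRep μ g ∘L T = T ∘L leftRep μ g)
    {l : Filter Γ} [l.NeBot]
    (hmix : ∀ f h : L2 μ, Tendsto (fun g => ⟪f, leftRep μ g h⟫_ℂ) l (𝓝 0))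
    {ψ : L2 μ} (hψ : T ψ = (‖T‖ : ℂ) • ψ) : ψ = 0 := by
  by_contra hψ0
  have hne : ∀ f : L2 μ, IsNonneg f → f ≠ 0 → T f = (‖T‖ : ℂ) • f → ∀ᵐ m ∂μ, f m ≠ 0 := by
    intro f hf hf0 hTf
    filter_upwards [hT.ae_ne_zero hf hf0, Lp.coeFn_smul (‖T‖ : ℂ) f] with m hm hm' hfm
    rw [hTf, hm', Pi.smul_apply, hfm, smul_zero] at hm
    exact hm rfl
  set f := modulus ψ with hf
  have hfT : T f = (‖T‖ : ℂ) • f := hT.map_modulus hψ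
  have hf_nonneg : IsNonneg f := isNonneg_modulus ψ
  have hinv : ∀ g : Γ, leftRep μ g f = f := by
    intro g
    have hgT : T (leftRep μ g f) = (‖T‖ : ℂ) • leftRep μ g f := by
      have h := congrArg (fun S : L2 μ →L[ℂ] L2 μ => S f) (hcomm g)
      simp only [ContinuousLinearMap.comp_apply] at h
      rw [← h, hfT, map_smul]
    have hg_nonneg : IsNonneg (leftRep μ g f) := by
      filter_upwards [leftRep_coeFn g f,
        (measurePreserving_smul g⁻¹ μ).quasiMeasurePreserving.ae hf_nonneg] with x hx hx'
      rw [hx, hx']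
      simp
    obtain ⟨d, hd⟩ : ∃ d, d = f - leftRep μ g f := ⟨_, rfl⟩
    have hdT : T d = (‖T‖ : ℂ) • d := by rw [hd, map_sub, hfT, hgT, smul_sub]
    have hdT' := hT.map_modulus hdT
    have hdreal : ∀ᵐ x ∂μ, ∃ r : ℝ, d x = r := by
      filter_upwards [hf_nonneg, hg_nonneg, Lp.coeFn_sub f (leftRep μ g f)] with x h₁ h₂ h₃
      exact ⟨‖f x‖ - ‖leftRep μ g f x‖, by rw [hd, h₃, Pi.sub_apply, h₁, h₂]; simp⟩
    have hp : IsNonneg (modulus d + d) := by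
      filter_upwards [modulus_coeFn d, hdreal, Lp.coeFn_add (modulus d) d] with x h₁ ⟨r, hr⟩ h₃
      rw [h₃, Pi.add_apply, h₁, hr, Complex.norm_real, ← Complex.ofReal_add, Complex.norm_real,
        Real.norm_of_nonneg (r := ‖r‖ + r)]
      linarith [neg_abs_le r, Real.norm_eq_abs r]
    have hq : IsNonneg (modulus d - d) := by
      filter_upwards [modulus_coeFn d, hdreal, Lp.coeFn_sub (modulus d) d] with x h₁ ⟨r, hr⟩ h₃
      rw [h₃, Pi.sub_apply, h₁, hr, Complex.norm_real, ← Complex.ofReal_sub, Complex.norm_real,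
        Real.norm_of_nonneg (r := ‖r‖ - r)]
      linarith [le_abs_self r, Real.norm_eq_abs r]
    -- `|d| ± d` are nonnegative, solve the ground state equation and have product zero, while a
    -- nonzero one vanishes almost nowhere. So one of them is zero and `d` has constant sign; as `f`
    -- and its translate have equal norms, `d = 0`.
    have hd0 : d = 0 := by
      by_cases hp0 : modulus d + d = 0
      · have h₁ : leftRep μ g f = f + modulus d := by
          rw [eq_neg_of_add_eq_zero_left hp0, hd]
          abel
        have h₂ := @norm_add_sq ℂ _ _ _ _ f (modulus d)
        rw [← h₁, norm_leftRep, norm_modulus d] at h₂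
        have h₃ := hf_nonneg.re_inner_nonneg (isNonneg_modulus d)
        have h₄ : ‖d‖ ^ 2 = 0 := le_antisymm (by linarith) (sq_nonneg _)
        simpa using h₄
      by_cases hq0 : modulus d - d = 0
      · have h₁ : f = leftRep μ g f + modulus d := by
          rw [sub_eq_zero.1 hq0, hd]
          abel
        have h₂ := @norm_add_sq ℂ _ _ _ _ (leftRep μ g f) (modulus d)
        rw [← h₁, norm_leftRep, norm_modulus d] at h₂
        have h₃ := hg_nonneg.re_inner_nonneg (isNonneg_modulus d)
        have h₄ : ‖d‖ ^ 2 = 0 := le_antisymm (by linarith) (sq_nonneg _)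
        simpa using h₄
      have hfalse : ∀ᵐ _ ∂μ, False := by
        filter_upwards [hne _ hp hp0 (by rw [map_add, hdT, hdT', smul_add]),
          hne _ hq hq0 (by rw [map_sub, hdT, hdT', smul_sub]), modulus_coeFn d, hdreal,
          Lp.coeFn_add (modulus d) d, Lp.coeFn_sub (modulus d) d] with x h₁ h₂ h₃ ⟨r, hr⟩ h₅ h₆
        rw [h₅, Pi.add_apply, h₃, hr, Complex.norm_real, ← Complex.ofReal_add, Ne,
          Complex.ofReal_eq_zero] at h₁
        rw [h₆, Pi.sub_apply, h₃, hr, Complex.norm_real, ← Complex.ofReal_sub, Ne,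
          Complex.ofReal_eq_zero] at h₂
        rw [Real.norm_eq_abs] at h₁ h₂
        rcases abs_choice r with h | h
        · exact h₂ (by linarith)
        · exact h₁ (by linarith)
      -- If neither vanished, `μ` would be zero, and `ψ` with it.
      exact absurd ((Lp.eq_zero_iff_ae_eq_zero).2 (hfalse.mono fun _ h => h.elim)) hψ0
    exact (sub_eq_zero.1 (hd.symm.trans hd0)).symm
  have hlim := hmix f f
  simp only [hinv] at hlim
  have h0 : f = 0 := inner_self_eq_zero.1 (tendsto_nhds_unique tendsto_const_nhds hlim)
  rw [← norm_eq_zero, norm_modulus, norm_eq_zero] at h0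
  exact hψ0 h0

end Kernels

end SpinSystem

namespace SpinSystem

/-! ### Spectral points that are not eigenvalues -/

section SpectralTop

variable {H : Type*} [NormedAddCommGroup H] [InnerProductSpace ℂ H]

/-- A symmetric operator is bounded below by `ε` on the closed span of the eigenvectors whose
eigenvalues have absolute value at least `ε`. -/
lemma norm_le_norm_sub_of_mem_closure {T : H →L[ℂ] H}
    (hT : (T.toLinearMap : H →ₗ[ℂ] H).IsSymmetric) {c : ℂ} {ε : ℝ} (hε : 0 ≤ ε)
    (hgap : ∀ z, eigenspace T z ≠ ⊥ → ε ≤ ‖z - c‖) {x : H}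
    (hx : x ∈ (⨆ z : ℂ, eigenspace T z).topologicalClosure) : ε * ‖x‖ ≤ ‖T x - c • x‖ := by
  -- The estimate is a closed condition, so finite sums of eigenvectors suffice; for these,
  -- orthogonality of eigenspaces reduces it to each summand.
  have hclosed : IsClosed {x : H | ε * ‖x‖ ≤ ‖T x - c • x‖} :=
    isClosed_le (by fun_prop) (by fun_prop)
  refine hclosed.closure_subset_iff.2 ?_ hx
  intro x hx
  classical
  obtain ⟨v, rfl⟩ := (Submodule.mem_iSup_iff_exists_dfinsupp' _ x).1 hx
  have horth := hT.orthogonalFamily_eigenspaces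
  have h₁ : (v.sum fun _ y => (y : H)) = ∑ z ∈ v.support, (v z : H) := rfl
  have h₂ : T (∑ z ∈ v.support, (v z : H)) - c • ∑ z ∈ v.support, (v z : H) =
      ∑ z ∈ v.support, (((z - c) • v z : eigenspace T z) : H) := by
    rw [map_sum, Finset.smul_sum, ← Finset.sum_sub_distrib]
    refine Finset.sum_congr rfl fun z _ => ?_
    have hz : T (v z : H) = z • (v z : H) := Module.End.mem_eigenspace_iff.1 (v z).2
    rw [hz, Submodule.coe_smul, sub_smul]
  have h₃ := horth.norm_sum (fun z => v z) v.support
  have h₄ := horth.norm_sum (fun z => (z - c) • v z) v.support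
  simp only [Submodule.coe_subtypeₗᵢ, Submodule.subtype_apply] at h₃ h₄
  rw [Set.mem_ofPred_eq, h₁, h₂]
  refine le_of_sq_le_sq ?_ (norm_nonneg _)
  rw [mul_pow, h₃, h₄, Finset.mul_sum]
  refine Finset.sum_le_sum fun z hz => ?_
  rw [norm_smul, mul_pow]
  have : ε ≤ ‖z - c‖ := hgap z fun hbot => by
    refine (DFinsupp.mem_support_iff.1 hz) (Subtype.ext ?_)
    exact (Submodule.mem_bot ℂ).1 (hbot ▸ (v z).2)
  gcongr

variable [CompleteSpace H]

/-- `S²` is coercive, as `⟪S² x, x⟫ = ‖S x‖² ≥ ε² ‖x‖²`, hence invertible, and so is its factor `S`.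
-/
lemma isUnit_of_isSymmetric_of_le_norm {S : H →L[ℂ] H}
    (hS : (S.toLinearMap : H →ₗ[ℂ] H).IsSymmetric) {ε : ℝ} (hε : 0 < ε)
    (h : ∀ x, ε * ‖x‖ ≤ ‖S x‖) : IsUnit S := by
  have h2 : IsUnit (S * S) := by
    refine ContinuousLinearMap.isUnit_of_forall_le_norm_inner_map _ (c := ⟨ε ^ 2, by positivity⟩)
      (NNReal.coe_pos.1 (by positivity : (0 : ℝ) < ε ^ 2)) fun x => ?_
    have h₁ : ⟪(S * S) x, x⟫_ℂ = ⟪S x, S x⟫_ℂ := hS (S x) x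
    rw [h₁, inner_self_eq_norm_sq_to_K, norm_pow]
    have h₂ : ‖((‖S x‖ : ℝ) : ℂ)‖ = ‖S x‖ := by simp
    have h₃ := pow_le_pow_left₀ (by positivity) (h x) 2
    change ‖x‖ ^ 2 * ε ^ 2 ≤ ‖((‖S x‖ : ℝ) : ℂ)‖ ^ 2
    rw [h₂]
    linarith [mul_pow ε ‖x‖ 2]
  exact ((Commute.refl S).isUnit_mul_iff.1 h2).1

/-- A point of the spectrum of a selfadjoint operator lies in the continuous spectrum, or is an
eigenvalue, or is a limit point of eigenvalues. -/
lemma mem_continuousSpectrum_or_accPt {T : H →L[ℂ] H}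
    (hT : (T.toLinearMap : H →ₗ[ℂ] H).IsSymmetric) {c : ℝ} (hc : (c : ℂ) ∈ spectrum ℂ T)
    (hne : eigenspace T c = ⊥) :
    (c : ℂ) ∈ continuousSpectrum T ∨ AccPt (c : ℂ) (𝓟 {z | eigenspace T z ≠ ⊥}) := by
  by_contra! hcon
  obtain ⟨hcs, hacc⟩ := hcon
  have hgap : ∃ ε > 0, ∀ z, eigenspace T z ≠ ⊥ → ε ≤ ‖z - c‖ := by
    rw [accPt_iff_nhds] at hacc
    push Not at hacc
    obtain ⟨U, hU, hUz⟩ := hacc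
    obtain ⟨ε, hε, hball⟩ := Metric.mem_nhds_iff.1 hU
    refine ⟨ε, hε, fun z hz => ?_⟩
    by_contra! hlt
    have := hUz z ⟨hball (by rwa [Metric.mem_ball, dist_eq_norm]), hz⟩
    -- Only a punctured ball is free of eigenvalues a priori; its centre is excluded by `hne`.
    exact hz (this ▸ hne)
  obtain ⟨ε₁, hε₁, hgap⟩ := hgap
  set W : Submodule ℂ H := ⨆ z : ℂ, eigenspace T z with hW
  let S : H →L[ℂ] H := T - (c : ℂ) • 1
  have hSx : ∀ x, S x = T x - (c : ℂ) • x := fun x => rfl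
  have hS : (S.toLinearMap : H →ₗ[ℂ] H).IsSymmetric := by
    intro x y
    change ⟪S x, y⟫_ℂ = ⟪x, S y⟫_ℂ
    have := hT x y
    change ⟪T x, y⟫_ℂ = ⟪x, T y⟫_ℂ at this
    rw [hSx, hSx, inner_sub_left, inner_sub_right, this, inner_smul_left, inner_smul_right,
      Complex.conj_ofReal]
  have hinvW : ∀ x ∈ W, S x ∈ W := by
    intro x hx
    have hmap : W.map S.toLinearMap ≤ W := by
      rw [hW, Submodule.map_iSup]
      refine iSup_mono fun z => ?_
      rintro _ ⟨y, hy, rfl⟩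
      have hTy : T y = z • y := Module.End.mem_eigenspace_iff.1 hy
      change T y - (c : ℂ) • y ∈ _
      rw [hTy, ← sub_smul]
      exact Submodule.smul_mem _ _ hy
    exact hmap ⟨x, hx, rfl⟩
  have hinv_orth : ∀ V : Submodule ℂ H, (∀ x ∈ V, S x ∈ V) → ∀ x ∈ Vᗮ, S x ∈ Vᗮ := by
    intro V hV x hx
    rw [Submodule.mem_orthogonal] at hx ⊢
    exact fun u hu => (hS u x).symm.trans (hx _ (hV u hu))
  have hcont : ∃ ε > 0, ∀ x ∈ Wᗮ, ε * ‖x‖ ≤ ‖S x‖ := by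
    obtain ⟨u, hu⟩ := spectrum.notMem_iff.1 hcs
    let R : continuousSubspace T →L[ℂ] continuousSubspace T := ↑u⁻¹
    -- The bound comes from the resolvent `R` of the continuous part; `+ 1` covers `R = 0`, when the
    -- continuous subspace is trivial.
    refine ⟨(‖R‖ + 1)⁻¹, by positivity, fun x hx => ?_⟩
    rw [inv_mul_le_iff₀ (by positivity)]
    let x' : continuousSubspace T := ⟨x, hx⟩
    have h₁ : R ((algebraMap ℂ _ (c : ℂ) - continuousPart T) x') = x' := by
      rw [← hu]
      change ((↑u⁻¹ : continuousSubspace T →L[ℂ] continuousSubspace T) * ↑u) x' = x'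
      rw [Units.inv_mul]
      rfl
    have h₂ : (algebraMap ℂ _ (c : ℂ) - continuousPart T) x' =
        -(continuousSubspace T).orthogonalProjectionOnto (S x) := by
      have h₃ : (continuousSubspace T).orthogonalProjectionOnto x = x' :=
        Submodule.orthogonalProjectionOnto_mem_subspace_eq_self x'
      rw [hSx, map_sub, map_smul, h₃, neg_sub]
      rfl
    calc ‖x‖ = ‖x'‖ := rfl
      _ ≤ ‖R‖ * ‖(continuousSubspace T).orthogonalProjectionOnto (S x)‖ := by
        rw [← norm_neg ((continuousSubspace T).orthogonalProjectionOnto (S x)), ← h₂]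
        conv_lhs => rw [← h₁]
        exact R.le_opNorm _
      _ ≤ (‖R‖ + 1) * ‖S x‖ := by
        gcongr
        · linarith
        · exact Submodule.norm_orthogonalProjectionOnto_apply_le _ _
  obtain ⟨ε₂, hε₂, hcont⟩ := hcont
  have hpp : ∀ x ∈ Wᗮᗮ, ε₁ * ‖x‖ ≤ ‖S x‖ := fun x hx => by
    rw [Submodule.orthogonal_orthogonal_eq_closure] at hx
    exact norm_le_norm_sub_of_mem_closure hT hε₁.le hgap hx
  -- `Wᗮ` and `Wᗮᗮ` are `S`-invariant and span `H` orthogonally, so the two lower bounds combine by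
  -- Pythagoras.
  have hunit : IsUnit S := by
    refine isUnit_of_isSymmetric_of_le_norm hS (lt_min hε₁ hε₂) fun x => ?_
    obtain ⟨y, hy, z, hz, rfl⟩ := (Wᗮ).exists_add_mem_mem_orthogonal x
    refine le_of_sq_le_sq ?_ (norm_nonneg _)
    have h₁ : ‖y + z‖ ^ 2 = ‖y‖ ^ 2 + ‖z‖ ^ 2 := by
      simpa [sq] using norm_add_sq_eq_norm_sq_add_norm_sq_of_inner_eq_zero y z
        (Submodule.inner_right_of_mem_orthogonal hy hz)
    have h₂ : ‖S y + S z‖ ^ 2 = ‖S y‖ ^ 2 + ‖S z‖ ^ 2 := by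
      simpa [sq] using norm_add_sq_eq_norm_sq_add_norm_sq_of_inner_eq_zero (S y) (S z)
        (Submodule.inner_right_of_mem_orthogonal (hinv_orth W hinvW y hy)
          (hinv_orth _ (hinv_orth W hinvW) z hz))
    have h₃ : (min ε₁ ε₂ * ‖y‖) ^ 2 ≤ ‖S y‖ ^ 2 := by
      refine pow_le_pow_left₀ (by positivity) (le_trans ?_ (hcont y hy)) 2
      gcongr
      exact min_le_right _ _
    have h₄ : (min ε₁ ε₂ * ‖z‖) ^ 2 ≤ ‖S z‖ ^ 2 := by
      refine pow_le_pow_left₀ (by positivity) (le_trans ?_ (hpp z hz)) 2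
      gcongr
      exact min_le_left _ _
    rw [map_add, h₂, mul_pow, h₁, mul_add, ← mul_pow, ← mul_pow]
    exact add_le_add h₃ h₄
  rw [spectrum.mem_iff, ← IsUnit.neg_iff, neg_sub] at hc
  exact hc hunit

lemma norm_mem_spectrum_of_isPositive [Nontrivial H] {T : H →L[ℂ] H} (hT : T.IsPositive) :
    (‖T‖ : ℂ) ∈ spectrum ℂ T := by
  have h := CStarAlgebra.norm_mem_spectrum_of_nonneg (a := T)
    ((ContinuousLinearMap.nonneg_iff_isPositive T).2 hT)
  exact spectrum.algebraMap_mem ℂ h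

end SpectralTop

/-- Needed because on the zero space every spectrum is empty, so the norm could not belong to it. -/
lemma nontrivial_L2 {X : Type*} [MeasurableSpace X] {μ : Measure X} [SigmaFinite μ] (hμ : μ ≠ 0) :
    Nontrivial (L2 μ) := by
  obtain ⟨s, hs, -, hs0, hs1⟩ := Measure.exists_subset_measure_lt_top (μ := μ) (r := 0)
    MeasurableSet.univ (by simpa [pos_iff_ne_zero] using hμ)
  refine ⟨indicatorConstLp 2 hs hs1.ne (1 : ℂ), 0, fun h => ?_⟩
  have hnorm := norm_indicatorConstLp (μ := μ) (c := (1 : ℂ)) (hs := hs) (hμs := hs1.ne)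
    two_ne_zero ENNReal.ofNat_ne_top
  rw [h, norm_zero, norm_one, one_mul] at hnorm
  have hpos : 0 < μ.real s := ENNReal.toReal_pos hs0.ne' hs1.ne
  exact (Real.rpow_pos_of_pos hpos _).ne hnorm

end SpinSystem

/-! ### The proposition -/

theorem proposition3p1 {𝕜 : Type*} [RCLike 𝕜] (N : ℕ)
    (G : Subgroup (GL (Fin N) 𝕜)) (hG : SpinSystem.IsLinearReductive G) (hGnc : ¬ CompactSpace G)
    (K : Subgroup G) (hK : SpinSystem.IsMaximalCompact K)
    (γ : Measure (SpinSystem.SpinSpace K)) [IsLocallyFiniteMeasure γ]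
    [SMulInvariantMeasure G (SpinSystem.SpinSpace K) γ] (hγ : γ ≠ 0)
    (ν : ℕ) (hν : 2 ≤ ν) :
    (∀ A : SpinSystem.L2 (SpinSystem.configMeasure γ ν) →L[ℂ]
        SpinSystem.L2 (SpinSystem.configMeasure γ ν),
      SpinSystem.IsStandardInvariant G (SpinSystem.configMeasure γ ν) A →
        spectrum ℂ A = SpinSystem.essentialSpectrum A) ∧
    (∀ T : SpinSystem.L2 (SpinSystem.configMeasure γ ν) →L[ℂ]
        SpinSystem.L2 (SpinSystem.configMeasure γ ν),
      SpinSystem.IsTransferOperator (SpinSystem.configMeasure γ ν) T →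
      (∀ g : G, SpinSystem.leftRep (SpinSystem.configMeasure γ ν) g ∘L T =
        T ∘L SpinSystem.leftRep (SpinSystem.configMeasure γ ν) g) →
        (¬ ∃ ψ : SpinSystem.L2 (SpinSystem.configMeasure γ ν),
          ψ ≠ 0 ∧ T ψ = (‖T‖ : ℂ) • ψ) ∧
        ((‖T‖ : ℂ) ∈ SpinSystem.continuousSpectrum T ∨
          AccPt (‖T‖ : ℂ) (𝓟 (SpinSystem.infiniteEigenvalues T)))) := by
  have hKc : IsCompact (K : Set G) := hK.prop
  have hν0 : ν ≠ 0 := by lia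
  have : LocallyCompactSpace (Matrix (Fin N) (Fin N) 𝕜) :=
    inferInstanceAs (LocallyCompactSpace (Fin N → Fin N → 𝕜))
  have : LocallyCompactSpace G := hG.isClosed.isClosedEmbedding_subtypeVal.locallyCompactSpace
  -- This makes `cocompact G` a proper filter, so that limits along it are unique and the decay has
  -- content.
  have : NoncompactSpace G := not_compactSpace_iff.1 hGnc
  obtain ⟨B, hmono, hmeas, hcover, hdisj⟩ := SpinSystem.exists_exhaustion hKc hν0
  have hmix := SpinSystem.tendsto_inner_leftRep (μ := SpinSystem.configMeasure γ ν) hmono hmeas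
    hcover hdisj
  have hbot : ∀ A : SpinSystem.L2 (SpinSystem.configMeasure γ ν) →L[ℂ]
        SpinSystem.L2 (SpinSystem.configMeasure γ ν),
      (∀ g : G, SpinSystem.leftRep (SpinSystem.configMeasure γ ν) g ∘L A =
        A ∘L SpinSystem.leftRep (SpinSystem.configMeasure γ ν) g) →
      ∀ z, FiniteDimensional ℂ (SpinSystem.eigenspace A z) → SpinSystem.eigenspace A z = ⊥ :=
    fun A hA z => SpinSystem.eigenspace_eq_bot_of_commute
      (fun g ψ => SpinSystem.norm_leftRep g ψ) hmix hA z
  refine ⟨fun A hA => ?_, fun T hT hcomm => ?_⟩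
  · refine (sdiff_eq_left.2 (Set.disjoint_left.2 ?_)).symm
    rintro z - ⟨-, -, hne, hfin⟩
    exact hne (hbot A hA.leftRep_comm z hfin)
  · have hground : ∀ ψ, T ψ = (‖T‖ : ℂ) • ψ → ψ = 0 := fun ψ hψ =>
      hT.eq_zero_of_map_eq hcomm hmix hψ
    refine ⟨fun ⟨ψ, hψ0, hψ⟩ => hψ0 (hground ψ hψ), ?_⟩
    have hmeasure : SpinSystem.configMeasure γ ν ≠ 0 := by
      rw [← Measure.measure_univ_ne_zero, Measure.pi_univ]
      exact Finset.prod_ne_zero_iff.2 fun _ _ => Measure.measure_univ_ne_zero.2 hγ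
    have := SpinSystem.nontrivial_L2 hmeasure
    have hground' : SpinSystem.eigenspace T (‖T‖ : ℂ) = ⊥ :=
      (Submodule.eq_bot_iff _).2 fun ψ hψ => hground ψ (Module.End.mem_eigenspace_iff.1 hψ)
    refine (SpinSystem.mem_continuousSpectrum_or_accPt hT.1.isSymmetric
      (SpinSystem.norm_mem_spectrum_of_isPositive hT.1) hground').imp id fun hacc => ?_
    -- Every eigenvalue has infinite multiplicity, by `hbot`.
    exact hacc.mono (principal_mono.2 fun z hz hfin => hz (hbot T hcomm z hfin))
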